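/- For a formal power series $A(x)=\sum_{n\ge0}A_nx^n$ over $\mathbb Q$ and $n\ge 0$ put $H_n(A)=\det(A_{i+j})_{0\le i,j\le n-1}$ and $H_n^1(A)=\det(A_{i+j+1})_{0\le i,j\le n-1}$ (the determinant of a $0\times0$ matrix is $1$), and let $(u)_n=u(u+1)\cdots(u+n-1)$. Let $f=\sum_{n\ge1}\frac1{2n+1}\binom{3n}{n}x^n$, and let $a_n,b_n,c_n,d_n,e_n$ be the coefficients of $x^n$ in $1+f$, $(1+f)^2$, $(1+f)(2+f)$, $(1+f)(2-f)$ and $(1+f)(5+2f)$ respectively; write $H_n(a)=H_n\bigl(\sum_n a_nx^n\bigr)$, and similarly for $H_n^1$ and for the other letters. Let $$U_n=\det\Bigl(\tfrac1{2(i+j)+1}\tbinom{3(i+j)}{i+j}\Bigr)_{0\le i,j\le n-1},\qquad V_n=\det\Bigl(\tfrac1{2(i+j+1)+1}\tbinom{3(i+j+1)}{i+j+1}\Bigr)_{0\le i,j\le n-1}.$$ (1) For all $n\ge0$, $$a_n=\frac{(3n)!}{n!\,(2n+1)!}=\frac1{2n+1}\binom{3n}n,\qquad b_n=\frac{(3n+1)!}{(n+1)!\,(2n+1)!}=\frac1{n+1}\binom{3n+1}n,$$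 $$c_n=2\frac{(3n)!}{(n+1)!\,(2n)!}=\frac2{n+1}\binom{3n}n=a_n+b_n,\qquad d_n=2\frac{(3n)!}{(n+1)!\,(2n+1)!}=3a_n-b_n,$$ $$e_n=(9n+5)\frac{(3n)!}{(n+1)!\,(2n+1)!}=3a_n+2b_n.$$ (2) For all $n\ge0$, \begin{align*} H_n(a)&=\prod_{i=0}^{n-1}\frac{(\frac23)_i(\frac16)_i(\frac43)_i(\frac56)_i}{(\frac12)_{2i}(\frac32)_{2i}}\left(\tfrac{27}4\right)^{2i},& H_n^1(a)&=\prod_{i=1}^{n}\frac23\,\frac{(\frac23)_i(\frac16)_i(\frac13)_i(-\frac16)_i}{(\frac12)_{2i}(-\frac12)_{2i}}\left(\tfrac{27}4\right)^{2i},\\ H_n(b)&=\prod_{i=0}^{n-1}\frac{(\frac43)_i(\frac56)_i(\frac53)_i(\frac76)_i}{(\frac32)_{2i}(\frac52)_{2i}}\left(\tfrac{27}4\right)^{2i},& H_n^1(b)&=\prod_{i=1}^{n}\frac{(\frac43)_i(\frac56)_i(\frac23)_i(\frac16)_i}{(\frac32)_{2i}(\frac12)_{2i}}\left(\tfrac{27}4\right)^{2i},\\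 H_n(c)&=\prod_{i=0}^{n-1}2\,\frac{(\frac53)_i(\frac76)_i(\frac73)_i(\frac{11}6)_i}{(\frac52)_{2i}(\frac72)_{2i}}\left(\tfrac{27}4\right)^{2i},& H_n^1(c)&=\prod_{i=1}^{n}\frac{(\frac53)_i(\frac76)_i(\frac43)_i(\frac56)_i}{(\frac52)_{2i}(\frac32)_{2i}}\left(\tfrac{27}4\right)^{2i},\\ H_n(d)&=\prod_{i=0}^{n-1}2\,\frac{(\frac53)_i(\frac16)_i(\frac73)_i(\frac56)_i}{(\frac52)_{2i}(\frac32)_{2i}}\left(\tfrac{27}4\right)^{2i},& H_n^1(d)&=(-1)^n\prod_{i=1}^{n}\frac{(\frac53)_i(\frac16)_i(\frac43)_i(-\frac16)_i}{(\frac32)_{2i}(\frac12)_{2i}}\left(\tfrac{27}4\right)^{2i},\\ H_n(e)&=\prod_{i=0}^{n-1}5\,\frac{(\frac23)_i(\frac76)_i(\frac43)_i(\frac{11}6)_i}{(\frac32)_{2i}(\frac52)_{2i}}\left(\tfrac{27}4\right)^{2i},& H_n^1(e)&=\prod_{i=1}^{n}2\,\frac{(\frac23)_i(\frac76)_i(\frac13)_i(\frac56)_i}{(\frac32)_{2i}(\frac12)_{2i}}\left(\tfrac{27}4\right)^{2i}.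 \end{align*} (3) $U_n=H_n(a)$ and $V_n=H_n^1(a)=H_n(b)$ for all $n\ge0$, and $U_n=H_{n-1}^1(b)=H_{n-1}(c)$ and $V_n=H_{n-1}^1(c)$ for all $n\ge1$. (4) For all $n\ge0$, $$U_n=\prod_{i=1}^{n-1}\frac{(3i+1)\,(6i)!\,(2i)!}{(4i+1)!\,(4i)!},\qquad V_n=\prod_{i=1}^{n}\frac{\binom{6i-2}{2i}}{2\binom{4i-1}{2i}}.$$ -/

import Mathlib

open scoped Nat

/-- The Hankel determinant `H_n^{(k)}(A) = det (A_{i+j+k})_{0 ≤ i, j ≤ n-1}` of a formal power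
series `A`; the `0 × 0` determinant is `1`. -/
noncomputable def hankelDet {R : Type*} [CommRing R] (k : ℕ) (A : PowerSeries R) (n : ℕ) : R :=
  Matrix.det (Matrix.of fun i j : Fin n => PowerSeries.coeff ((i : ℕ) + (j : ℕ) + k) A)

/-- The rising factorial `(u)_n = u (u + 1) ⋯ (u + n - 1)`. -/
noncomputable def poch (u : ℚ) (n : ℕ) : ℚ := (ascPochhammer ℚ n).eval u

/-- The number `1/(2n+1) * binom(3n, n)` of ternary trees with `n` vertices. -/
def ternaryNumber (n : ℕ) : ℚ := 1 / (2 * (n : ℚ) + 1) * ((3 * n).choose n : ℚ)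

/-- Somos's determinant `U_n`. -/
def somosU (n : ℕ) : ℚ :=
  Matrix.det (Matrix.of fun i j : Fin n => ternaryNumber ((i : ℕ) + (j : ℕ)))

/-- Somos's determinant `V_n`. -/
def somosV (n : ℕ) : ℚ :=
  Matrix.det (Matrix.of fun i j : Fin n => ternaryNumber ((i : ℕ) + (j : ℕ) + 1))

/-- `f = ∑_{n ≥ 1} 1/(2n+1) * binom(3n, n) x^n`. -/
noncomputable def ternaryF : PowerSeries ℚ :=
  PowerSeries.mk fun n => if n = 0 then 0 else ternaryNumber n

/-- The generating function `1 + f` of the sequence `a`. -/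
noncomputable def serA : PowerSeries ℚ := 1 + ternaryF

/-- The generating function `(1 + f)^2` of the sequence `b`. -/
noncomputable def serB : PowerSeries ℚ := (1 + ternaryF) ^ 2

/-- The generating function `(1 + f)(2 + f)` of the sequence `c`. -/
noncomputable def serC : PowerSeries ℚ := (1 + ternaryF) * (2 + ternaryF)

/-- The generating function `(1 + f)(2 - f)` of the sequence `d`. -/
noncomputable def serD : PowerSeries ℚ := (1 + ternaryF) * (2 - ternaryF)

/-- The generating function `(1 + f)(5 + 2 f)` of the sequence `e`. -/
noncomputable def serE : PowerSeries ℚ := (1 + ternaryF) * (5 + 2 * ternaryF)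

/-!
The five generating functions are, up to a constant factor, quotients
`₂F₁(a, b + 1; c + 1 | 27x/4) / ₂F₁(a, b; c | 27x/4)`, so that Gauss's continued fraction applies to
each of them, and the Hankel determinants can be read off from a continued fraction of this kind.

*Continued fractions and Hankel determinants.* If `A = 1 / (1 - x B)`, then
`(A(x) - A(y)) / (x - y) = A(x) A(y) (x B(x) - y B(y)) / (x - y)`, and a similar formula holds for
`(x A(x) - y A(y)) / (x - y)`. Multiplication by `A(x)` and `A(y)` is multiplication by a
unitriangular Toeplitz matrix, so `H¹_n(A) = H_n(B)` and `H_{n+1}(A) = H¹_n(B)`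
(`hankelDet_one_step`, `hankelDet_zero_step`). The contiguous relation `hyp_contiguous` gives such
an equation for a Gauss quotient, in which `B` is a constant times another Gauss quotient
(`gaussRatio_step`); two steps shift `(a, b, c)` to `(a + 1, b + 1, c + 2)`, and induction gives the
products (`hankelDet_zero_gaussRatio`, `hankelDet_one_gaussRatio`).

*The ternary tree series.* Let `Q_r = ∑ binom(3n + r, n) xⁿ` and `P_r = Q_r - 3x Q_{r+2}`, whose
coefficients are `r / (3n + r) binom(3n + r, n)`. By Pascal's rule both families satisfy
`G_{r+1} = G_r + x G_{r+3}`, which determines a family from `G_0`. As `P_0 = 1`, it follows that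
`P_r P_s = P_{r+s}` and `Q_r = Q_0 P_r` (`fussP_mul_fussP`, `fussQ_eq_mul_fussP`). Hence `P_r = T^r`
for `T = 1 + f = P_1`, which gives the coefficients of the powers of `T` and the functional equation
`T = 1 + x T³`.

*The quotients.* In the order `a, b, c, d, e` they are `Q_1 / Q_0`, `Q_3 / Q_1`,
`(Q_4 + Q_5) / Q_3`, `(3/2) Q_1' / Q_0'` and `(3 T² + 2 T³) / T`; numerators and denominators
are recognised as hypergeometric series by their two-term recurrences. The coincidences between the
determinants hold because `T = 1 / (1 - x T²)` and `T² = 1 / (1 - x (T + T²))`.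
-/

/-! ### Hankel determinants and continued fraction steps -/

/-- The `k`-fold shift `∑ₙ A_{n+k} xⁿ` of a power series. -/
noncomputable def shiftSeries {R : Type*} [CommRing R] (k : ℕ) (A : PowerSeries R) :
    PowerSeries R :=
  PowerSeries.mk fun n => PowerSeries.coeff (n + k) A

section HankelStep

variable {R : Type*} [CommRing R]

/-- Multiplying by a series with constant term `1` is a unitriangular column operation. -/
theorem det_coeff_mul (A : PowerSeries R) (hA : PowerSeries.coeff 0 A = 1) (n : ℕ)
    (G : ℕ → PowerSeries R) :
    Matrix.det (Matrix.of fun i j : Fin n => PowerSeries.coeff (i : ℕ) (A * G j)) =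
      Matrix.det (Matrix.of fun i j : Fin n => PowerSeries.coeff (i : ℕ) (G j)) := by
  let L : Matrix (Fin n) (Fin n) R := Matrix.of fun i k =>
    if (k : ℕ) ≤ i then PowerSeries.coeff ((i : ℕ) - k) A else 0
  have hL : L.det = 1 := by
    rw [Matrix.det_of_isLowerTriangular]
    · simp [L, hA]
    · intro i j hij
      have : i < j := hij
      simp [L, this]
  have hmul : (Matrix.of fun i j : Fin n => PowerSeries.coeff (i : ℕ) (A * G j)) =
      L * Matrix.of fun i j : Fin n => PowerSeries.coeff (i : ℕ) (G j) := by
    ext i j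
    rw [Matrix.mul_apply]
    simp only [Matrix.of_apply, L]
    rw [mul_comm A, PowerSeries.coeff_mul, Finset.Nat.sum_antidiagonal_eq_sum_range_succ
      (fun p q => PowerSeries.coeff p (G j) * PowerSeries.coeff q A)]
    rw [Fin.sum_univ_eq_sum_range (fun k => (if k ≤ (i : ℕ) then
      PowerSeries.coeff ((i : ℕ) - k) A else 0) * PowerSeries.coeff k (G j)) n]
    rw [← Finset.sum_subset (Finset.range_mono (Nat.succ_le_of_lt i.2))]
    · refine Finset.sum_congr rfl fun k hk => ?_
      rw [if_pos (by simpa [Nat.lt_succ_iff] using hk), mul_comm]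
    · intro k _ hk
      rw [if_neg (by simpa [Nat.lt_succ_iff] using hk), zero_mul]
  rw [hmul, Matrix.det_mul, hL, one_mul]

theorem coeff_succ_mul_shift (A F : PowerSeries R) (i : ℕ) :
    PowerSeries.coeff (i + 1) (A * F) =
      PowerSeries.coeff i (A * shiftSeries 1 F) +
        PowerSeries.coeff (i + 1) A * PowerSeries.coeff 0 F := by
  rw [PowerSeries.coeff_mul, Finset.Nat.sum_antidiagonal_succ', PowerSeries.coeff_mul, add_comm]
  simp [shiftSeries]

theorem shiftSeries_one_shiftSeries (A : PowerSeries R) (k : ℕ) :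
    shiftSeries 1 (shiftSeries k A) = shiftSeries (k + 1) A := by
  ext n
  simp only [shiftSeries, PowerSeries.coeff_mk]
  rw [add_right_comm, add_assoc]

/-- If `A = 1 / (1 - x B)`, the shifted Hankel matrix of `A` is the Hankel matrix of `B`
multiplied on the left and on the right by the Toeplitz matrix of `A` and its transpose. -/
theorem coeff_hankel_step {A B : PowerSeries R} (h : A = 1 + PowerSeries.X * (A * B)) (i j : ℕ) :
    PowerSeries.coeff (i + j + 1) A = PowerSeries.coeff j
      (A * PowerSeries.mk fun l => PowerSeries.coeff i (A * shiftSeries l B)) := by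
  have h0 : PowerSeries.coeff 0 A = 1 := by rw [h]; simp
  have h1 : ∀ n, PowerSeries.coeff (n + 1) A = PowerSeries.coeff n (A * B) := by
    intro n
    conv_lhs => rw [h]
    rw [map_add, PowerSeries.coeff_succ_X_mul, PowerSeries.coeff_one]
    simp
  induction i generalizing j with
  | zero =>
    rw [zero_add, h1]
    congr 2
    ext l
    rw [PowerSeries.coeff_mk, PowerSeries.coeff_mul]
    simp only [PowerSeries.coeff_zero_eq_constantCoeff] at h0
    simp [shiftSeries, h0]
  | succ i ih =>
    have hM : (PowerSeries.mk fun l => PowerSeries.coeff (i + 1) (A * shiftSeries l B)) =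
        shiftSeries 1 (PowerSeries.mk fun l => PowerSeries.coeff i (A * shiftSeries l B)) +
          PowerSeries.C (PowerSeries.coeff (i + 1) A) * B := by
      ext l
      rw [PowerSeries.coeff_mk, coeff_succ_mul_shift, shiftSeries_one_shiftSeries]
      simp [shiftSeries]
    rw [hM, show i + 1 + j + 1 = i + (j + 1) + 1 by ring, ih (j + 1), coeff_succ_mul_shift,
      mul_add, map_add, PowerSeries.coeff_mk, h1 j, mul_left_comm, PowerSeries.coeff_C_mul, h1 i,
      mul_comm (PowerSeries.coeff j _)]
    have hB : shiftSeries 0 B = B := by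
      ext n
      simp [shiftSeries]
    rw [hB]

/-- The matrix of `coeff i (A * shiftSeries (l + s) B)` has the determinant of the `s`-shifted
Hankel matrix of `B`. -/
theorem det_coeff_mul_shift {A : PowerSeries R} (B : PowerSeries R)
    (hA : PowerSeries.coeff 0 A = 1) (n s : ℕ) :
    Matrix.det (Matrix.of fun i l : Fin n =>
      PowerSeries.coeff (i : ℕ) (A * shiftSeries ((l : ℕ) + s) B)) = hankelDet s B n := by
  rw [det_coeff_mul A hA n fun l => shiftSeries (l + s) B, hankelDet]
  congr 1
  ext i l
  simp [shiftSeries, add_assoc]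

/-- The continued fraction step `A = 1 / (1 - x B)` for the shifted Hankel determinant. -/
theorem hankelDet_one_step {A B : PowerSeries R} (h : A = 1 + PowerSeries.X * (A * B)) (n : ℕ) :
    hankelDet 1 A n = hankelDet 0 B n := by
  have h0 : PowerSeries.coeff 0 A = 1 := by rw [h]; simp
  rw [← det_coeff_mul_shift B h0 n 0, hankelDet, ← Matrix.det_transpose,
    ← Matrix.det_transpose (Matrix.of fun i l : Fin n =>
      PowerSeries.coeff (i : ℕ) (A * shiftSeries ((l : ℕ) + 0) B))]
  have := det_coeff_mul A h0 n fun j =>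
    PowerSeries.mk fun l => PowerSeries.coeff j (A * shiftSeries l B)
  convert this using 2
  · ext i j
    simp only [Matrix.transpose_apply, Matrix.of_apply]
    rw [coeff_hankel_step h]
  · ext i j
    simp

/-- The continued fraction step `A = 1 / (1 - x B)` for the unshifted Hankel determinant: after the
Toeplitz factor of `A` is removed on one side, the first column is a unit vector. -/
theorem hankelDet_zero_step {A B : PowerSeries R} (h : A = 1 + PowerSeries.X * (A * B)) (n : ℕ) :
    hankelDet 0 A (n + 1) = hankelDet 1 B n := by
  have h0 : PowerSeries.coeff 0 A = 1 := by rw [h]; simp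
  -- column `0` of the Hankel matrix is `A` itself, column `j + 1` is `A` times the series in
  -- `coeff_hankel_step`
  let G : ℕ → PowerSeries R := fun j => Nat.casesOn j 1 fun j =>
    PowerSeries.mk fun l => PowerSeries.coeff j (A * shiftSeries l B)
  have hG := det_coeff_mul A h0 (n + 1) G
  have e1 : hankelDet 0 A (n + 1) =
      Matrix.det (Matrix.of fun i j : Fin (n + 1) => PowerSeries.coeff (i : ℕ) (A * G j)) := by
    rw [hankelDet]
    congr 1
    ext i j
    refine Fin.cases ?_ (fun j => ?_) j
    · simp [G]
    · simp only [Matrix.of_apply, Fin.val_succ, G]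
      rw [← coeff_hankel_step h, add_zero, add_left_comm, add_assoc]
  rw [e1, hG, Matrix.det_succ_column_zero, Finset.sum_eq_single 0]
  · rw [← det_coeff_mul_shift B h0 n 1, ← Matrix.det_transpose (Matrix.of fun i l : Fin n =>
      PowerSeries.coeff (i : ℕ) (A * shiftSeries ((l : ℕ) + 1) B))]
    have hc : PowerSeries.coeff ((0 : Fin (n + 1)) : ℕ) (G ((0 : Fin (n + 1)) : ℕ)) = 1 := by
      simp [G]
    rw [Matrix.of_apply, hc, Fin.val_zero, pow_zero, one_mul, one_mul]
    congr 1
    ext i j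
    simp [G]
  · intro i _ hi
    have : (i : ℕ) ≠ 0 := fun h => hi (Fin.ext h)
    simp [G, PowerSeries.coeff_one, this]
  · simp

theorem hankelDet_C_mul (k : ℕ) (u : R) (A : PowerSeries R) (n : ℕ) :
    hankelDet k (PowerSeries.C u * A) n = u ^ n * hankelDet k A n := by
  have : (Matrix.of fun i j : Fin n =>
      PowerSeries.coeff ((i : ℕ) + (j : ℕ) + k) (PowerSeries.C u * A)) =
      u • Matrix.of fun i j : Fin n => PowerSeries.coeff ((i : ℕ) + (j : ℕ) + k) A := by
    ext i j
    simp
  rw [hankelDet, this, Matrix.det_smul, Fintype.card_fin, hankelDet]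

end HankelStep

/-! ### Gauss's continued fraction for hypergeometric series -/

theorem poch_succ (u : ℚ) (n : ℕ) : poch u (n + 1) = poch u n * (u + n) := by
  simp [poch, ascPochhammer_succ_eval]

theorem poch_succ_left (u : ℚ) (n : ℕ) : poch u (n + 1) = u * poch (u + 1) n := by
  simp [poch, ascPochhammer_succ_left, Polynomial.eval_comp]

@[simp]
theorem poch_zero (u : ℚ) : poch u 0 = 1 := by
  simp [poch]

theorem poch_ne_zero {u : ℚ} (hu : ∀ n : ℕ, u + n ≠ 0) (n : ℕ) : poch u n ≠ 0 := by
  induction n with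
  | zero => simp
  | succ n ih => rw [poch_succ]; exact mul_ne_zero ih (hu n)

/-- The hypergeometric series `₂F₁(a, b; c | z x)` as a power series in `x`. -/
noncomputable def hyp (z a b c : ℚ) : PowerSeries ℚ :=
  PowerSeries.mk fun n => poch a n * poch b n / (poch c n * n !) * z ^ n

theorem hyp_comm (z a b c : ℚ) : hyp z a b c = hyp z b a c := by
  ext n
  simp [hyp, mul_comm]

theorem constantCoeff_hyp (z a b c : ℚ) : PowerSeries.constantCoeff (hyp z a b c) = 1 := by
  rw [← PowerSeries.coeff_zero_eq_constantCoeff_apply]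
  simp [hyp]

theorem hyp_ne_zero (z a b c : ℚ) : hyp z a b c ≠ 0 := by
  intro h
  simpa [h] using constantCoeff_hyp z a b c

theorem add_one_add_ne_zero {c : ℚ} (hc : ∀ n : ℕ, c + n ≠ 0) (n : ℕ) : c + 1 + n ≠ 0 := by
  have := hc (n + 1)
  push_cast at this
  rwa [add_assoc, add_comm 1]

/-- A power series is recognised as a hypergeometric series by its two-term recurrence. -/
theorem eq_C_mul_hyp {z a b c : ℚ} (hc : ∀ n : ℕ, c + n ≠ 0) {u : ℚ} {F : PowerSeries ℚ}
    (h0 : PowerSeries.coeff 0 F = u)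
    (h : ∀ n : ℕ, PowerSeries.coeff (n + 1) F * ((c + n) * (n + 1)) =
      PowerSeries.coeff n F * ((a + n) * (b + n) * z)) :
    F = PowerSeries.C u * hyp z a b c := by
  ext n
  rw [PowerSeries.coeff_C_mul]
  induction n with
  | zero => simp [h0, hyp]
  | succ n ih =>
    have h1 := hc n
    have h2 : (n : ℚ) + 1 ≠ 0 := by positivity
    have h3 := poch_ne_zero hc n
    have h4 : (n ! : ℚ) ≠ 0 := by positivity
    have h5 : (c + n) * ((n : ℚ) + 1) ≠ 0 := mul_ne_zero h1 h2
    rw [← mul_left_inj' h5, h n, ih]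
    simp only [hyp, PowerSeries.coeff_mk, poch_succ, Nat.factorial_succ]
    push_cast
    field_simp
    ring

/-- The partial numerator `a (c - b) / (c (c + 1)) z` of Gauss's continued fraction. -/
def gaussCoeff (z a b c : ℚ) : ℚ := a * (c - b) / (c * (c + 1)) * z

/-- Gauss's contiguous relation. -/
theorem hyp_contiguous {z a b c : ℚ} (hc : ∀ n : ℕ, c + n ≠ 0) :
    hyp z a (b + 1) (c + 1) = hyp z a b c + PowerSeries.X *
      (PowerSeries.C (gaussCoeff z a b c) * hyp z (a + 1) (b + 1) (c + 1 + 1)) := by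
  ext n
  cases n with
  | zero => simp [constantCoeff_hyp]
  | succ n =>
    have hc0 : c ≠ 0 := by simpa using hc 0
    have hc1 : c + 1 ≠ 0 := by simpa using hc 1
    have h3 := poch_ne_zero (add_one_add_ne_zero (add_one_add_ne_zero hc)) n
    have h4 : (n ! : ℚ) ≠ 0 := by positivity
    have h2 : (n : ℚ) + 1 ≠ 0 := by positivity
    have h6 := add_one_add_ne_zero hc n
    -- `(c)_{n+1}` and `(c+1)_{n+1}` in terms of `(c+2)_n`
    have e1 : poch c (n + 1) * (c + 1 + n) = c * (c + 1) * poch (c + 1 + 1) n := by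
      rw [poch_succ_left, mul_assoc, ← poch_succ, poch_succ_left]; ring
    have e2 : poch (c + 1) (n + 1) = (c + 1) * poch (c + 1 + 1) n := poch_succ_left _ _
    have e3 : poch c (n + 1) = c * (c + 1) * poch (c + 1 + 1) n / (c + 1 + n) := by
      rw [← e1, mul_div_cancel_right₀ _ h6]
    rw [map_add, PowerSeries.coeff_succ_X_mul, PowerSeries.coeff_C_mul]
    simp only [hyp, PowerSeries.coeff_mk, e2, e3, poch_succ_left a, poch_succ_left b,
      poch_succ (b + 1), Nat.factorial_succ, gaussCoeff]
    push_cast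
    field_simp
    ring

/-- The quotient `₂F₁(a, b + 1; c + 1 | z x) / ₂F₁(a, b; c | z x)`. -/
noncomputable def gaussRatio (z a b c : ℚ) : PowerSeries ℚ :=
  hyp z a (b + 1) (c + 1) * (hyp z a b c)⁻¹

theorem gaussRatio_mul_hyp (z a b c : ℚ) :
    gaussRatio z a b c * hyp z a b c = hyp z a (b + 1) (c + 1) := by
  rw [gaussRatio, mul_assoc, PowerSeries.inv_mul_cancel, mul_one]
  simp [constantCoeff_hyp]

/-- One step of Gauss's continued fraction. -/
theorem gaussRatio_step {z a b c : ℚ} (hc : ∀ n : ℕ, c + n ≠ 0) :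
    gaussRatio z a b c = 1 + PowerSeries.X * (gaussRatio z a b c *
      (PowerSeries.C (gaussCoeff z a b c) * gaussRatio z (b + 1) a (c + 1))) := by
  have h1 := gaussRatio_mul_hyp z a b c
  have h2 := gaussRatio_mul_hyp z (b + 1) a (c + 1)
  rw [hyp_comm z (b + 1) a, hyp_comm z (b + 1) (a + 1)] at h2
  have h3 := hyp_contiguous (z := z) (a := a) (b := b) hc
  refine mul_right_cancel₀ (hyp_ne_zero z a b c) ?_
  linear_combination h1 + h3 - PowerSeries.X * PowerSeries.C (gaussCoeff z a b c) * h2 -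
    PowerSeries.X * PowerSeries.C (gaussCoeff z a b c) * gaussRatio z (b + 1) a (c + 1) * h1

/-- The factor with index `i` in the product for `H_n(gaussRatio z a b c)`. -/
noncomputable def gaussFactor (z a b c : ℚ) (i : ℕ) : ℚ :=
  poch a i * poch (c - b) i * poch (b + 1) i * poch (c + 1 - a) i /
    (poch c (2 * i) * poch (c + 1) (2 * i)) * z ^ (2 * i)

theorem gaussFactor_succ {z a b c : ℚ} (hc : ∀ n : ℕ, c + n ≠ 0) (i : ℕ) :
    gaussFactor z a b c (i + 1) = gaussCoeff z a b c * gaussCoeff z (b + 1) a (c + 1) *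
      gaussFactor z (a + 1) (b + 1) (c + 1 + 1) i := by
  have hc0 : c ≠ 0 := by simpa using hc 0
  have hc1 : c + 1 ≠ 0 := by simpa using hc 1
  have hc2 := add_one_add_ne_zero (add_one_add_ne_zero hc)
  have hc2' : c + 1 + 1 ≠ 0 := by simpa using hc2 0
  have h1 := poch_ne_zero hc2 (2 * i)
  have h2 := poch_ne_zero (add_one_add_ne_zero hc2) (2 * i)
  have e1 : c + 1 + 1 - (b + 1) = c - b + 1 := by ring
  have e2 : c + 1 + 1 + 1 - (a + 1) = c + 1 - a + 1 := by ring
  have e3 : 2 * (i + 1) = 2 * i + 1 + 1 := by ring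
  simp only [gaussFactor, gaussCoeff, e1, e2, e3, poch_succ_left a i, poch_succ_left (c - b) i,
    poch_succ_left (b + 1) i, poch_succ_left (c + 1 - a) i, poch_succ_left c,
    poch_succ_left (c + 1), poch_succ_left (c + 1 + 1)]
  field_simp
  ring

/-- Two continued fraction steps shift `(a, b, c)` to `(a + 1, b + 1, c + 2)` and lower the size of
the determinant by one. -/
theorem hankelDet_zero_gaussRatio (z a b c : ℚ) (hc : ∀ n : ℕ, c + n ≠ 0) (n : ℕ) :
    hankelDet 0 (gaussRatio z a b c) n = ∏ i ∈ Finset.range n, gaussFactor z a b c i := by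
  induction n generalizing a b c with
  | zero => simp [hankelDet]
  | succ n ih =>
    rw [hankelDet_zero_step (gaussRatio_step hc), hankelDet_C_mul,
      hankelDet_one_step (gaussRatio_step (add_one_add_ne_zero hc)), hankelDet_C_mul,
      ih _ _ _ (add_one_add_ne_zero (add_one_add_ne_zero hc)), Finset.prod_range_succ']
    simp only [gaussFactor_succ hc, Finset.prod_mul_distrib, Finset.prod_const, Finset.card_range]
    simp [gaussFactor, mul_assoc]

/-- The factor with index `i` in the product for `H¹_n(gaussRatio z a b c)`. -/
noncomputable def gaussFactorOne (z a b c : ℚ) (i : ℕ) : ℚ :=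
  poch a i * poch (c - b) i * poch b i * poch (c - a) i /
    (poch c (2 * i) * poch (c - 1) (2 * i)) * z ^ (2 * i)

/-- The index shift absorbs the first partial numerator, at the cost of a constant free of `i`. This
is where `b` and `c - a` must not vanish. -/
theorem gaussFactorOne_succ {z a b c : ℚ} (hc : ∀ n : ℕ, c - 1 + n ≠ 0) (hz : z ≠ 0)
    (hb : b ≠ 0) (hca : c - a ≠ 0) (i : ℕ) :
    c * (c - 1) / (b * (c - a) * z) * gaussFactorOne z a b c (i + 1) =
      gaussCoeff z a b c * gaussFactor z (b + 1) a (c + 1) i := by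
  have hc' : ∀ n : ℕ, c + n ≠ 0 := by simpa using add_one_add_ne_zero hc
  have hcm : c - 1 ≠ 0 := by simpa using hc 0
  have hc0 : c ≠ 0 := by simpa using hc' 0
  have hc1 : c + 1 ≠ 0 := by simpa using hc' 1
  have hc2 := add_one_add_ne_zero hc'
  have h1 := poch_ne_zero hc2 (2 * i)
  have h2 := poch_ne_zero (add_one_add_ne_zero hc2) (2 * i)
  have e1 : c + 1 - a = c - a + 1 := by ring
  have e2 : c + 1 + 1 - (b + 1) = c - b + 1 := by ring
  have e3 : 2 * (i + 1) = 2 * i + 1 + 1 := by ring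
  simp only [gaussFactor, gaussFactorOne, gaussCoeff, e1, e2, e3, poch_succ_left a i,
    poch_succ_left (c - b) i, poch_succ_left b i, poch_succ_left (c - a) i, poch_succ_left c,
    poch_succ_left (c + 1), poch_succ_left (c - 1), sub_add_cancel]
  field_simp
  ring

theorem hankelDet_one_gaussRatio (z a b c : ℚ) (hc : ∀ n : ℕ, c - 1 + n ≠ 0) (hz : z ≠ 0)
    (hb : b ≠ 0) (hca : c - a ≠ 0) (n : ℕ) :
    hankelDet 1 (gaussRatio z a b c) n = ∏ i ∈ Finset.Icc 1 n,
      (c * (c - 1) / (b * (c - a) * z) * gaussFactorOne z a b c i) := by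
  have hc' : ∀ n : ℕ, c + n ≠ 0 := by simpa using add_one_add_ne_zero hc
  rw [hankelDet_one_step (gaussRatio_step hc'), hankelDet_C_mul,
    hankelDet_zero_gaussRatio _ _ _ _ (add_one_add_ne_zero hc'), ← Finset.Ico_add_one_right_eq_Icc,
    Finset.prod_Ico_eq_prod_range, Nat.add_sub_cancel]
  simp only [add_comm 1, gaussFactorOne_succ hc hz hb hca, Finset.prod_mul_distrib,
    Finset.prod_const, Finset.card_range]

theorem eq_C_mul_gaussRatio {z a b c u : ℚ} {A : PowerSeries ℚ}
    (h : A * hyp z a b c = PowerSeries.C u * hyp z a (b + 1) (c + 1)) :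
    A = PowerSeries.C u * gaussRatio z a b c := by
  refine mul_right_cancel₀ (hyp_ne_zero z a b c) ?_
  rw [h, mul_assoc, gaussRatio_mul_hyp]

theorem hankelDet_zero_of_ratio {z a b c u : ℚ} {A : PowerSeries ℚ} (hc : ∀ n : ℕ, c + n ≠ 0)
    (h : A * hyp z a b c = PowerSeries.C u * hyp z a (b + 1) (c + 1)) (n : ℕ) :
    hankelDet 0 A n = ∏ i ∈ Finset.range n, (u * gaussFactor z a b c i) := by
  rw [eq_C_mul_gaussRatio h, hankelDet_C_mul, hankelDet_zero_gaussRatio _ _ _ _ hc]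
  simp [Finset.prod_mul_distrib]

theorem hankelDet_one_of_ratio {z a b c u : ℚ} {A : PowerSeries ℚ}
    (hc : ∀ n : ℕ, c - 1 + n ≠ 0) (hz : z ≠ 0) (hb : b ≠ 0) (hca : c - a ≠ 0)
    (h : A * hyp z a b c = PowerSeries.C u * hyp z a (b + 1) (c + 1)) (n : ℕ) :
    hankelDet 1 A n = ∏ i ∈ Finset.Icc 1 n,
      (u * (c * (c - 1) / (b * (c - a) * z)) * gaussFactorOne z a b c i) := by
  rw [eq_C_mul_gaussRatio h, hankelDet_C_mul, hankelDet_one_gaussRatio _ _ _ _ hc hz hb hca]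
  simp [Finset.prod_mul_distrib, mul_assoc]

/-! ### Powers of the generating function of ternary trees -/

/-- The series `∑ₙ binom(3n + r, n) xⁿ`. -/
noncomputable def fussQ (r : ℕ) : PowerSeries ℚ :=
  PowerSeries.mk fun n => ((3 * n + r).choose n : ℚ)

/-- The series `∑ₙ r / (3n + r) binom(3n + r, n) xⁿ`, with constant term `1` also for `r = 0`. It
turns out to be the `r`-th power of the generating function of ternary trees. -/
noncomputable def fussP (r : ℕ) : PowerSeries ℚ :=
  fussQ r - 3 * (PowerSeries.X * fussQ (r + 2))

theorem fussQ_succ (r : ℕ) : fussQ (r + 1) = fussQ r + PowerSeries.X * fussQ (r + 3) := by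
  ext n
  cases n with
  | zero => simp [fussQ]
  | succ n =>
    rw [map_add, PowerSeries.coeff_succ_X_mul]
    simp only [fussQ, PowerSeries.coeff_mk]
    rw [show 3 * (n + 1) + (r + 1) = (3 * (n + 1) + r) + 1 by ring, Nat.choose_succ_succ,
      show 3 * n + (r + 3) = 3 * (n + 1) + r by ring]
    push_cast
    ring

theorem fussP_succ (r : ℕ) : fussP (r + 1) = fussP r + PowerSeries.X * fussP (r + 3) := by
  simp only [fussP]
  linear_combination fussQ_succ r - 3 * PowerSeries.X * fussQ_succ (r + 2)

/-- The recurrence shared by `fussP` and `fussQ` determines a family from its initial member. -/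
theorem eq_of_fuss_recurrence {G G' : ℕ → PowerSeries ℚ}
    (hG : ∀ r, G (r + 1) = G r + PowerSeries.X * G (r + 3))
    (hG' : ∀ r, G' (r + 1) = G' r + PowerSeries.X * G' (r + 3)) (h0 : G 0 = G' 0) (r : ℕ) :
    G r = G' r := by
  -- the `n`-th coefficient of `G (r + 1)` depends on that of `G r` and on earlier ones
  have key : ∀ n r, PowerSeries.coeff n (G r) = PowerSeries.coeff n (G' r) := by
    intro n
    induction n with
    | zero =>
      intro r
      induction r with
      | zero => rw [h0]
      | succ r ih => simpa [hG r, hG' r] using ih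
    | succ n ihn =>
      intro r
      induction r with
      | zero => rw [h0]
      | succ r ih => simp [hG r, hG' r, PowerSeries.coeff_succ_X_mul, ih, ihn]
  exact PowerSeries.ext fun n => key n r

theorem choose_eq_factorial (r n : ℕ) :
    ((3 * n + r).choose n : ℚ) = (3 * n + r)! / (n ! * (2 * n + r)!) := by
  rw [show 3 * n + r = n + (2 * n + r) by ring, Nat.cast_add_choose]

theorem choose_succ_right_param (r n : ℕ) :
    ((3 * n + (r + 1)).choose n : ℚ) * (2 * n + r + 1) =
      ((3 * n + r).choose n : ℚ) * (3 * n + r + 1) := by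
  rw [choose_eq_factorial, choose_eq_factorial, ← add_assoc, ← add_assoc]
  simp only [Nat.factorial_succ]
  push_cast
  field_simp

theorem choose_succ_index (r n : ℕ) :
    ((3 * (n + 1) + r).choose (n + 1) : ℚ) * ((n + 1) * (2 * n + r + 1) * (2 * n + r + 2)) =
      ((3 * n + r).choose n : ℚ) * ((3 * n + r + 1) * (3 * n + r + 2) * (3 * n + r + 3)) := by
  rw [choose_eq_factorial, choose_eq_factorial,
    show 3 * (n + 1) + r = 3 * n + r + 1 + 1 + 1 by ring,
    show 2 * (n + 1) + r = 2 * n + r + 1 + 1 by ring]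
  simp only [Nat.factorial_succ]
  push_cast
  field_simp
  ring

theorem choose_add_two (r n : ℕ) :
    ((3 * n + (r + 2)).choose n : ℚ) =
      ((3 * n + r).choose n : ℚ) * ((3 * n + r + 1) * (3 * n + r + 2)) /
        ((2 * n + r + 1) * (2 * n + r + 2)) := by
  have h1 := choose_succ_right_param r n
  have h2 := choose_succ_right_param (r + 1) n
  push_cast at h2
  rw [eq_div_iff (by positivity)]
  linear_combination (2 * n + r + 1 : ℚ) * h2 + (3 * n + r + 2 : ℚ) * h1

theorem coeff_fussP_mul (r n : ℕ) :
    PowerSeries.coeff n (fussP r) * (3 * n + r) = r * ((3 * n + r).choose n : ℚ) := by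
  cases n with
  | zero => simp [fussP, fussQ]
  | succ n =>
    have h3 : PowerSeries.coeff (n + 1) (fussP r) =
        ((3 * (n + 1) + r).choose (n + 1) : ℚ) - 3 * ((3 * n + (r + 2)).choose n : ℚ) := by
      rw [fussP, map_sub, show (3 : PowerSeries ℚ) = PowerSeries.C 3 from (map_ofNat _ 3).symm,
        PowerSeries.coeff_C_mul, PowerSeries.coeff_succ_X_mul]
      simp [fussQ]
    have h4 : ((3 * (n + 1) + r).choose (n + 1) : ℚ) = ((3 * n + r).choose n : ℚ) *
        ((3 * n + r + 1) * (3 * n + r + 2) * (3 * n + r + 3)) /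
          ((n + 1) * (2 * n + r + 1) * (2 * n + r + 2)) := by
      rw [eq_div_iff (by positivity), choose_succ_index]
    rw [h3, h4, choose_add_two]
    push_cast
    field_simp
    ring

theorem coeff_fussP_succ (r n : ℕ) :
    PowerSeries.coeff n (fussP (r + 1)) =
      (r + 1) / (2 * n + r + 1) * ((3 * n + r).choose n : ℚ) := by
  have h1 := coeff_fussP_mul (r + 1) n
  have h2 := choose_succ_right_param r n
  have h3 : ((3 * n + (r + 1)).choose n : ℚ) =
      ((3 * n + r).choose n : ℚ) * (3 * n + r + 1) / (2 * n + r + 1) := by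
    rw [eq_div_iff (by positivity), h2]
  have h4 : (3 * n + r + 1 : ℚ) ≠ 0 := by positivity
  rw [← mul_left_inj' h4]
  push_cast at h1
  rw [← add_assoc] at h1
  rw [h1, h3]
  field_simp

/-- `binom(3n, n) = 3 binom(3n - 1, n - 1)`, which starts the recurrence for `fussP`. -/
theorem fussP_zero : fussP 0 = 1 := by
  ext n
  cases n with
  | zero => simp [fussP, fussQ]
  | succ n =>
    have h := coeff_fussP_mul 0 (n + 1)
    have h' : (3 * ((n + 1 : ℕ) : ℚ) + ((0 : ℕ) : ℚ)) ≠ 0 := by positivity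
    rw [Nat.cast_zero, zero_mul] at h
    rw [PowerSeries.coeff_one, if_neg n.succ_ne_zero]
    exact (mul_eq_zero.mp h).resolve_right (by simpa using h')

/-- Rothe's convolution identity. -/
theorem fussP_mul_fussP (r s : ℕ) : fussP r * fussP s = fussP (r + s) := by
  refine eq_of_fuss_recurrence (G := fun r => fussP r * fussP s) (G' := fun r => fussP (r + s))
    (fun r => ?_) (fun r => ?_) ?_ r
  · simp only [fussP_succ r]
    ring
  · simp only [add_right_comm r _ s]
    exact fussP_succ (r + s)
  · simp [fussP_zero]

theorem fussQ_eq_mul_fussP (r : ℕ) : fussQ r = fussQ 0 * fussP r := by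
  refine eq_of_fuss_recurrence (G := fussQ) (G' := fun r => fussQ 0 * fussP r)
    fussQ_succ (fun r => ?_) ?_ r
  · simp only [fussP_succ r]
    ring
  · simp [fussP_zero]

theorem coeff_serA (n : ℕ) : PowerSeries.coeff n serA = ternaryNumber n := by
  cases n with
  | zero => simp [serA, ternaryF, ternaryNumber]
  | succ n => simp [serA, ternaryF, PowerSeries.coeff_one]

theorem serA_eq_fussP : serA = fussP 1 := by
  ext n
  rw [coeff_serA, coeff_fussP_succ, ternaryNumber]
  simp

theorem fussP_eq_pow (r : ℕ) : fussP r = serA ^ r := by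
  induction r with
  | zero => simp [fussP_zero]
  | succ r ih => rw [← fussP_mul_fussP, ih, serA_eq_fussP, pow_succ]

/-- The functional equation `T = 1 + x T³` of the generating function of ternary trees. -/
theorem serA_eq : serA = 1 + PowerSeries.X * serA ^ 3 := by
  have h := fussP_succ 0
  rwa [fussP_eq_pow, fussP_eq_pow, fussP_eq_pow, zero_add, zero_add, pow_one, pow_zero] at h

theorem serB_eq : serB = serA ^ 2 := rfl

theorem serC_eq : serC = serA + serA ^ 2 := by
  simp only [serC, serA]; ring

theorem serD_eq : serD = 3 * serA - serA ^ 2 := by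
  simp only [serD, serA]; ring

theorem serE_eq : serE = 3 * serA + 2 * serA ^ 2 := by
  simp only [serE, serA]; ring

theorem serA_step : serA = 1 + PowerSeries.X * (serA * serB) := by
  rw [serB_eq]
  linear_combination serA_eq

theorem serB_step : serB = 1 + PowerSeries.X * (serB * serC) := by
  rw [serB_eq, serC_eq]
  linear_combination (serA + 1) * serA_eq

/-- With `Q₀ = T / (3 - 2 T)` and `Q₁ = Q₀ T`, the derivatives of `Q₀` and `Q₁` have quotient
`(2/3) T (3 - T)`. -/
theorem derivative_fussQ : 3 * PowerSeries.derivative ℚ (fussQ 1) =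
    2 * (serD * PowerSeries.derivative ℚ (fussQ 0)) := by
  have hQ1 : fussQ 1 = fussQ 0 * serA := by rw [fussQ_eq_mul_fussP, fussP_eq_pow, pow_one]
  -- `Q₀ (1 - 3 x T²) = 1`
  have hQ0 : fussQ 0 - 3 * (PowerSeries.X * (fussQ 0 * serA ^ 2)) = 1 := by
    rw [← fussP_zero, fussP, fussQ_eq_mul_fussP (0 + 2), fussP_eq_pow]
  have hQT : fussQ 0 * (3 - 2 * serA) = serA := by
    linear_combination serA * hQ0 - 3 * fussQ 0 * serA_eq
  have d1 := congrArg (PowerSeries.derivative ℚ) hQT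
  have d2 := congrArg (PowerSeries.derivative ℚ) hQ1
  have hc : PowerSeries.derivative ℚ (3 - 2 * serA) = -2 * PowerSeries.derivative ℚ serA := by
    have h3 : PowerSeries.derivative ℚ (3 : PowerSeries ℚ) = 0 :=
      Derivation.map_natCast (PowerSeries.derivative ℚ) 3
    have h2 : PowerSeries.derivative ℚ (2 : PowerSeries ℚ) = 0 :=
      Derivation.map_natCast (PowerSeries.derivative ℚ) 2
    rw [map_sub, Derivation.leibniz, h3, h2]
    simp
  rw [Derivation.leibniz, hc] at d1
  rw [Derivation.leibniz] at d2
  simp only [smul_eq_mul] at d1 d2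
  rw [d2, serD_eq]
  linear_combination -serA * d1 + PowerSeries.derivative ℚ serA * hQT

/-! ### The five hypergeometric quotients -/

theorem coeff_fussQ_succ (r n : ℕ) : PowerSeries.coeff (n + 1) (fussQ r) =
    ((3 * n + r).choose n : ℚ) * ((3 * n + r + 1) * (3 * n + r + 2) * (3 * n + r + 3)) /
      ((n + 1) * (2 * n + r + 1) * (2 * n + r + 2)) := by
  rw [eq_div_iff (by positivity), ← choose_succ_index]
  simp [fussQ]

theorem coeff_fussQ (r n : ℕ) : PowerSeries.coeff n (fussQ r) = ((3 * n + r).choose n : ℚ) := by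
  simp [fussQ]

theorem fussQ_zero_eq_hyp : fussQ 0 = hyp (27 / 4) (2 / 3) (1 / 3) (1 / 2) := by
  rw [← one_mul (hyp _ _ _ _), ← map_one PowerSeries.C]
  refine eq_C_mul_hyp (fun n => by positivity) (by simp [fussQ]) fun n => ?_
  rw [coeff_fussQ_succ, coeff_fussQ]
  push_cast
  field_simp
  ring

theorem fussQ_one_eq_hyp : fussQ 1 = hyp (27 / 4) (2 / 3) (4 / 3) (3 / 2) := by
  rw [← one_mul (hyp _ _ _ _), ← map_one PowerSeries.C]
  refine eq_C_mul_hyp (fun n => by positivity) (by simp [fussQ]) fun n => ?_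
  rw [coeff_fussQ_succ, coeff_fussQ]
  push_cast
  field_simp
  ring

theorem fussQ_three_eq_hyp : fussQ 3 = hyp (27 / 4) (4 / 3) (5 / 3) (5 / 2) := by
  rw [← one_mul (hyp _ _ _ _), ← map_one PowerSeries.C]
  refine eq_C_mul_hyp (fun n => by positivity) (by simp [fussQ]) fun n => ?_
  rw [coeff_fussQ_succ, coeff_fussQ]
  push_cast
  field_simp
  ring

theorem fussQ_four_add_five_eq_hyp : fussQ 4 + fussQ 5 =
    PowerSeries.C 2 * hyp (27 / 4) (5 / 3) (7 / 3) (7 / 2) := by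
  refine eq_C_mul_hyp (fun n => by positivity) (by norm_num [fussQ]) fun n => ?_
  have h : ((3 * n + 5).choose n : ℚ) = ((3 * n + 4).choose n : ℚ) * (3 * n + 5) / (2 * n + 5) := by
    rw [eq_div_iff (by positivity)]
    have := choose_succ_right_param 4 n
    push_cast at this
    linear_combination this
  rw [map_add, map_add, coeff_fussQ_succ, coeff_fussQ_succ, coeff_fussQ, coeff_fussQ, h]
  push_cast
  field_simp
  ring

theorem derivative_fussQ_succ_ratio (r n : ℕ) :
    PowerSeries.coeff (n + 1) (PowerSeries.derivative ℚ (fussQ r)) *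
        ((n + 1) * (2 * n + r + 3) * (2 * n + r + 4)) =
      PowerSeries.coeff n (PowerSeries.derivative ℚ (fussQ r)) *
        ((3 * n + r + 4) * (3 * n + r + 5) * (3 * n + r + 6)) := by
  have h := coeff_fussQ_succ r (n + 1)
  rw [PowerSeries.coeff_derivative, PowerSeries.coeff_derivative, h, coeff_fussQ]
  push_cast
  field_simp
  ring

/-- Differentiating `₂F₁(2/3, 1/3; 1/2)` raises all three parameters by one. -/
theorem derivative_fussQ_zero_eq_hyp : PowerSeries.derivative ℚ (fussQ 0) =
    PowerSeries.C 3 * hyp (27 / 4) (5 / 3) (4 / 3) (3 / 2) := by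
  refine eq_C_mul_hyp (fun n => by positivity) ?_ fun n => ?_
  · rw [PowerSeries.coeff_derivative, coeff_fussQ]
    simp
  · have h := derivative_fussQ_succ_ratio 0 n
    have h' : (2 * n + 4 : ℚ) ≠ 0 := by positivity
    rw [← mul_left_inj' h']
    push_cast at h
    linear_combination (1 / 2 : ℚ) * h

/-- Differentiating `₂F₁(2/3, 4/3; 3/2)` raises all three parameters by one. -/
theorem derivative_fussQ_one_eq_hyp : PowerSeries.derivative ℚ (fussQ 1) =
    PowerSeries.C 4 * hyp (27 / 4) (5 / 3) (7 / 3) (5 / 2) := by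
  refine eq_C_mul_hyp (fun n => by positivity) ?_ fun n => ?_
  · rw [PowerSeries.coeff_derivative, coeff_fussQ]
    simp
  · have h := derivative_fussQ_succ_ratio 1 n
    have h' : (2 * n + 4 : ℚ) ≠ 0 := by positivity
    rw [← mul_left_inj' h']
    push_cast at h
    linear_combination (1 / 2 : ℚ) * h

theorem coeff_serA_succ (n : ℕ) : PowerSeries.coeff (n + 1) serA * ((2 * n + 3) * (2 * n + 2)) =
    PowerSeries.coeff n serA * (3 * (3 * n + 1) * (3 * n + 2)) := by
  have h := choose_succ_index 0 n
  have h' : ((3 * (n + 1)).choose (n + 1) : ℚ) = ((3 * n).choose n : ℚ) *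
      ((3 * n + 1) * (3 * n + 2) * (3 * n + 3)) / ((n + 1) * (2 * n + 1) * (2 * n + 2)) := by
    rw [eq_div_iff (by positivity)]
    simpa using h
  rw [coeff_serA, coeff_serA, ternaryNumber, ternaryNumber, h']
  push_cast
  field_simp
  ring

theorem serA_eq_hyp : serA = hyp (27 / 4) (2 / 3) (1 / 3) (3 / 2) := by
  rw [← one_mul (hyp _ _ _ _), ← map_one PowerSeries.C]
  refine eq_C_mul_hyp (fun n => by positivity) (by rw [coeff_serA]; simp [ternaryNumber])
    fun n => ?_
  have h := coeff_serA_succ n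
  linear_combination (1 / 4 : ℚ) * h

theorem coeff_serA_mul_serE (n : ℕ) : PowerSeries.coeff n (serE * serA) =
    15 * ((3 * n + 1).choose n : ℚ) / (2 * n + 3) := by
  have h1 := choose_succ_right_param 1 n
  have h2 : ((3 * n + 2).choose n : ℚ) = ((3 * n + 1).choose n : ℚ) * (3 * n + 2) / (2 * n + 2) := by
    rw [eq_div_iff (by positivity)]
    push_cast at h1
    linear_combination h1
  have e : serE * serA = PowerSeries.C 3 * fussP (1 + 1) + PowerSeries.C 2 * fussP (2 + 1) := by
    rw [fussP_eq_pow, fussP_eq_pow, serE_eq, map_ofNat, map_ofNat]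
    ring
  rw [e, map_add, PowerSeries.coeff_C_mul, PowerSeries.coeff_C_mul, coeff_fussP_succ,
    coeff_fussP_succ, h2]
  push_cast
  field_simp
  ring

theorem serE_mul_serA_eq_hyp :
    serE * serA = PowerSeries.C 5 * hyp (27 / 4) (2 / 3) (4 / 3) (5 / 2) := by
  refine eq_C_mul_hyp (fun n => by positivity) (by rw [coeff_serA_mul_serE]; norm_num) fun n => ?_
  have h := coeff_fussQ_succ 1 n
  rw [coeff_fussQ] at h
  rw [coeff_serA_mul_serE, coeff_serA_mul_serE, h]
  push_cast
  field_simp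
  ring

theorem fussQ_add (r s : ℕ) : fussQ (r + s) = serA ^ s * fussQ r := by
  rw [fussQ_eq_mul_fussP, fussQ_eq_mul_fussP r, ← fussP_mul_fussP, fussP_eq_pow s]
  ring

theorem serA_ratio : serA * hyp (27 / 4) (2 / 3) (1 / 3) (1 / 2) =
    PowerSeries.C 1 * hyp (27 / 4) (2 / 3) (1 / 3 + 1) (1 / 2 + 1) := by
  rw [← fussQ_zero_eq_hyp, show (1 / 3 + 1 : ℚ) = 4 / 3 by norm_num,
    show (1 / 2 + 1 : ℚ) = 3 / 2 by norm_num, ← fussQ_one_eq_hyp, map_one, one_mul,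
    show (1 : ℕ) = 0 + 1 from rfl, fussQ_add, pow_one]

theorem serB_ratio : serB * hyp (27 / 4) (4 / 3) (2 / 3) (3 / 2) =
    PowerSeries.C 1 * hyp (27 / 4) (4 / 3) (2 / 3 + 1) (3 / 2 + 1) := by
  rw [hyp_comm _ (4 / 3) (2 / 3), ← fussQ_one_eq_hyp, show (2 / 3 + 1 : ℚ) = 5 / 3 by norm_num,
    show (3 / 2 + 1 : ℚ) = 5 / 2 by norm_num, ← fussQ_three_eq_hyp, map_one, one_mul,
    show (3 : ℕ) = 1 + 2 from rfl, fussQ_add, serB_eq]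

theorem serC_ratio : serC * hyp (27 / 4) (5 / 3) (4 / 3) (5 / 2) =
    PowerSeries.C 2 * hyp (27 / 4) (5 / 3) (4 / 3 + 1) (5 / 2 + 1) := by
  rw [hyp_comm _ (5 / 3) (4 / 3), ← fussQ_three_eq_hyp, show (4 / 3 + 1 : ℚ) = 7 / 3 by norm_num,
    show (5 / 2 + 1 : ℚ) = 7 / 2 by norm_num, ← fussQ_four_add_five_eq_hyp,
    show (4 : ℕ) = 3 + 1 from rfl, show (5 : ℕ) = 3 + 2 from rfl, fussQ_add, fussQ_add, serC_eq]
  ring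

theorem serD_ratio : serD * hyp (27 / 4) (5 / 3) (4 / 3) (3 / 2) =
    PowerSeries.C 2 * hyp (27 / 4) (5 / 3) (4 / 3 + 1) (3 / 2 + 1) := by
  have h := derivative_fussQ
  rw [derivative_fussQ_zero_eq_hyp, derivative_fussQ_one_eq_hyp, map_ofNat, map_ofNat] at h
  rw [show (4 / 3 + 1 : ℚ) = 7 / 3 by norm_num, show (3 / 2 + 1 : ℚ) = 5 / 2 by norm_num, map_ofNat]
  have h6 : (6 : PowerSeries ℚ) ≠ 0 := fun h0 => by
    have := congrArg PowerSeries.constantCoeff h0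
    rw [map_ofNat, map_zero] at this
    norm_num at this
  refine mul_left_cancel₀ h6 ?_
  linear_combination -h

theorem serE_ratio : serE * hyp (27 / 4) (2 / 3) (1 / 3) (3 / 2) =
    PowerSeries.C 5 * hyp (27 / 4) (2 / 3) (1 / 3 + 1) (3 / 2 + 1) := by
  rw [← serA_eq_hyp, show (1 / 3 + 1 : ℚ) = 4 / 3 by norm_num,
    show (3 / 2 + 1 : ℚ) = 5 / 2 by norm_num, ← serE_mul_serA_eq_hyp]

/-! ### Coefficients in closed form -/

theorem coeff_serA_factorial (n : ℕ) :
    PowerSeries.coeff n serA = ((3 * n)! : ℚ) / ((n ! : ℚ) * ((2 * n + 1)! : ℚ)) := by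
  have h := choose_eq_factorial 0 n
  rw [add_zero, add_zero] at h
  rw [coeff_serA, ternaryNumber, h, Nat.factorial_succ (2 * n)]
  push_cast
  field_simp

theorem coeff_serB (n : ℕ) :
    PowerSeries.coeff n serB = 1 / ((n : ℚ) + 1) * ((3 * n + 1).choose n : ℚ) := by
  rw [serB_eq, ← fussP_eq_pow, coeff_fussP_succ]
  push_cast
  field_simp
  ring

theorem coeff_serB_factorial (n : ℕ) : PowerSeries.coeff n serB =
    ((3 * n + 1)! : ℚ) / (((n + 1)! : ℚ) * ((2 * n + 1)! : ℚ)) := by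
  rw [coeff_serB, choose_eq_factorial, Nat.factorial_succ n]
  push_cast
  field_simp

theorem coeff_serB_eq_mul_serA (n : ℕ) :
    PowerSeries.coeff n serB = (3 * n + 1) / (n + 1) * PowerSeries.coeff n serA := by
  rw [coeff_serB_factorial, coeff_serA_factorial, Nat.factorial_succ n, Nat.factorial_succ (3 * n)]
  push_cast
  field_simp

theorem coeff_serC (n : ℕ) :
    PowerSeries.coeff n serC = PowerSeries.coeff n serA + PowerSeries.coeff n serB := by
  rw [serC_eq, ← serB_eq, map_add]

theorem coeff_serD (n : ℕ) :
    PowerSeries.coeff n serD = 3 * PowerSeries.coeff n serA - PowerSeries.coeff n serB := by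
  rw [serD_eq, ← serB_eq, ← map_ofNat PowerSeries.C 3, map_sub, PowerSeries.coeff_C_mul]

theorem coeff_serE (n : ℕ) :
    PowerSeries.coeff n serE = 3 * PowerSeries.coeff n serA + 2 * PowerSeries.coeff n serB := by
  rw [serE_eq, ← serB_eq, ← map_ofNat PowerSeries.C 3, ← map_ofNat PowerSeries.C 2, map_add,
    PowerSeries.coeff_C_mul, PowerSeries.coeff_C_mul]

/-! ### Somos's product formulas -/

theorem gaussFactor_eq_somosU_factor (i : ℕ) :
    gaussFactor (27 / 4) (2 / 3) (1 / 3) (1 / 2) i =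
      ((3 * (i : ℚ) + 1) * ((6 * i)! : ℚ) * ((2 * i)! : ℚ)) /
        (((4 * i + 1)! : ℚ) * ((4 * i)! : ℚ)) := by
  induction i with
  | zero => simp [gaussFactor]
  | succ i ih =>
    have h1 : poch (1 / 2) (2 * i) ≠ 0 := poch_ne_zero (fun n => by positivity) _
    have h2 : poch (1 / 2 + 1) (2 * i) ≠ 0 := poch_ne_zero (fun n => by positivity) _
    have e : gaussFactor (27 / 4) (2 / 3) (1 / 3) (1 / 2) (i + 1) =
        gaussFactor (27 / 4) (2 / 3) (1 / 3) (1 / 2) i *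
          ((2 / 3 + i) * (1 / 2 - 1 / 3 + i) * (1 / 3 + 1 + i) * (1 / 2 + 1 - 2 / 3 + i) /
            ((1 / 2 + 2 * i) * (1 / 2 + (2 * i + 1)) * (1 / 2 + 1 + 2 * i) *
              (1 / 2 + 1 + (2 * i + 1))) * (27 / 4) ^ 2) := by
      simp only [gaussFactor, show 2 * (i + 1) = 2 * i + 1 + 1 by ring, poch_succ, pow_succ]
      push_cast
      field_simp
    rw [e, ih, show 6 * (i + 1) = 6 * i + 1 + 1 + 1 + 1 + 1 + 1 by ring,
      show 2 * (i + 1) = 2 * i + 1 + 1 by ring, show 4 * (i + 1) = 4 * i + 1 + 1 + 1 + 1 by ring]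
    simp only [Nat.factorial_succ]
    push_cast
    field_simp
    ring

theorem choose_quotient_eq_factorial (i : ℕ) :
    ((6 * (i + 1) - 2).choose (2 * (i + 1)) : ℚ) / (2 * ((4 * (i + 1) - 1).choose (2 * (i + 1)) : ℚ))
      = ((6 * i + 4)! * (2 * i + 1)! : ℚ) / (2 * (4 * i + 2)! * (4 * i + 3)!) := by
  rw [show 6 * (i + 1) - 2 = 2 * (i + 1) + (4 * i + 2) by omega,
    show 4 * (i + 1) - 1 = 2 * (i + 1) + (2 * i + 1) by omega, Nat.cast_add_choose,
    Nat.cast_add_choose, show 2 * (i + 1) + (4 * i + 2) = 6 * i + 4 by ring,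
    show 2 * (i + 1) + (2 * i + 1) = 4 * i + 3 by ring]
  field_simp

theorem gaussFactor_eq_somosV_factor (i : ℕ) :
    gaussFactor (27 / 4) (4 / 3) (2 / 3) (3 / 2) i =
      ((6 * i + 4)! * (2 * i + 1)! : ℚ) / (2 * (4 * i + 2)! * (4 * i + 3)!) := by
  induction i with
  | zero => norm_num [gaussFactor, Nat.factorial]
  | succ i ih =>
    have h1 : poch (3 / 2) (2 * i) ≠ 0 := poch_ne_zero (fun n => by positivity) _
    have h2 : poch (3 / 2 + 1) (2 * i) ≠ 0 := poch_ne_zero (fun n => by positivity) _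
    have e : gaussFactor (27 / 4) (4 / 3) (2 / 3) (3 / 2) (i + 1) =
        gaussFactor (27 / 4) (4 / 3) (2 / 3) (3 / 2) i *
          ((4 / 3 + i) * (3 / 2 - 2 / 3 + i) * (2 / 3 + 1 + i) * (3 / 2 + 1 - 4 / 3 + i) /
            ((3 / 2 + 2 * i) * (3 / 2 + (2 * i + 1)) * (3 / 2 + 1 + 2 * i) *
              (3 / 2 + 1 + (2 * i + 1))) * (27 / 4) ^ 2) := by
      simp only [gaussFactor, show 2 * (i + 1) = 2 * i + 1 + 1 by ring, poch_succ, pow_succ]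
      push_cast
      field_simp
    rw [e, ih, show 6 * (i + 1) + 4 = 6 * i + 4 + 1 + 1 + 1 + 1 + 1 + 1 by ring,
      show 2 * (i + 1) + 1 = 2 * i + 1 + 1 + 1 by ring,
      show 4 * (i + 1) + 2 = 4 * i + 2 + 1 + 1 + 1 + 1 by ring,
      show 4 * (i + 1) + 3 = 4 * i + 3 + 1 + 1 + 1 + 1 by ring]
    simp only [Nat.factorial_succ (_ + _)]
    push_cast
    field_simp
    ring

theorem somosU_eq_hankelDet (n : ℕ) : somosU n = hankelDet 0 serA n := by
  simp [somosU, hankelDet, coeff_serA]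

theorem somosV_eq_hankelDet (n : ℕ) : somosV n = hankelDet 1 serA n := by
  simp [somosV, hankelDet, coeff_serA]

theorem mainTheorem2 :
    -- the coefficient sequences
    (∀ n : ℕ,
      PowerSeries.coeff n serA = ((3 * n)! : ℚ) / ((n ! : ℚ) * ((2 * n + 1)! : ℚ)) ∧
      PowerSeries.coeff n serA = 1 / (2 * (n : ℚ) + 1) * ((3 * n).choose n : ℚ)) ∧
    (∀ n : ℕ,
      PowerSeries.coeff n serB =
        ((3 * n + 1)! : ℚ) / (((n + 1)! : ℚ) * ((2 * n + 1)! : ℚ)) ∧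
      PowerSeries.coeff n serB = 1 / ((n : ℚ) + 1) * ((3 * n + 1).choose n : ℚ)) ∧
    (∀ n : ℕ,
      PowerSeries.coeff n serC = 2 * (((3 * n)! : ℚ) / (((n + 1)! : ℚ) * ((2 * n)! : ℚ))) ∧
      PowerSeries.coeff n serC = 2 / ((n : ℚ) + 1) * ((3 * n).choose n : ℚ) ∧
      PowerSeries.coeff n serC = PowerSeries.coeff n serA + PowerSeries.coeff n serB) ∧
    (∀ n : ℕ,
      PowerSeries.coeff n serD =
        2 * (((3 * n)! : ℚ) / (((n + 1)! : ℚ) * ((2 * n + 1)! : ℚ))) ∧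
      PowerSeries.coeff n serD = 3 * PowerSeries.coeff n serA - PowerSeries.coeff n serB) ∧
    (∀ n : ℕ,
      PowerSeries.coeff n serE =
        (9 * (n : ℚ) + 5) * (((3 * n)! : ℚ) / (((n + 1)! : ℚ) * ((2 * n + 1)! : ℚ))) ∧
      PowerSeries.coeff n serE = 3 * PowerSeries.coeff n serA + 2 * PowerSeries.coeff n serB) ∧
    -- the ten Hankel determinants
    (∀ n : ℕ, hankelDet 0 serA n =
      ∏ i ∈ Finset.range n,
        (((poch (2 / 3) i * poch (1 / 6) i * poch (4 / 3) i * poch (5 / 6) i) /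
          (poch (1 / 2) (2 * i) * poch (3 / 2) (2 * i))) * (27 / 4) ^ (2 * i))) ∧
    (∀ n : ℕ, hankelDet 1 serA n =
      ∏ i ∈ Finset.Icc 1 n,
        ((2 / 3) * ((poch (2 / 3) i * poch (1 / 6) i * poch (1 / 3) i * poch (-1 / 6) i) /
          (poch (1 / 2) (2 * i) * poch (-1 / 2) (2 * i))) * (27 / 4) ^ (2 * i))) ∧
    (∀ n : ℕ, hankelDet 0 serB n =
      ∏ i ∈ Finset.range n,
        (((poch (4 / 3) i * poch (5 / 6) i * poch (5 / 3) i * poch (7 / 6) i) /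
          (poch (3 / 2) (2 * i) * poch (5 / 2) (2 * i))) * (27 / 4) ^ (2 * i))) ∧
    (∀ n : ℕ, hankelDet 1 serB n =
      ∏ i ∈ Finset.Icc 1 n,
        (((poch (4 / 3) i * poch (5 / 6) i * poch (2 / 3) i * poch (1 / 6) i) /
          (poch (3 / 2) (2 * i) * poch (1 / 2) (2 * i))) * (27 / 4) ^ (2 * i))) ∧
    (∀ n : ℕ, hankelDet 0 serC n =
      ∏ i ∈ Finset.range n,
        (2 * ((poch (5 / 3) i * poch (7 / 6) i * poch (7 / 3) i * poch (11 / 6) i) /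
          (poch (5 / 2) (2 * i) * poch (7 / 2) (2 * i))) * (27 / 4) ^ (2 * i))) ∧
    (∀ n : ℕ, hankelDet 1 serC n =
      ∏ i ∈ Finset.Icc 1 n,
        (((poch (5 / 3) i * poch (7 / 6) i * poch (4 / 3) i * poch (5 / 6) i) /
          (poch (5 / 2) (2 * i) * poch (3 / 2) (2 * i))) * (27 / 4) ^ (2 * i))) ∧
    (∀ n : ℕ, hankelDet 0 serD n =
      ∏ i ∈ Finset.range n,
        (2 * ((poch (5 / 3) i * poch (1 / 6) i * poch (7 / 3) i * poch (5 / 6) i) /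
          (poch (5 / 2) (2 * i) * poch (3 / 2) (2 * i))) * (27 / 4) ^ (2 * i))) ∧
    (∀ n : ℕ, hankelDet 1 serD n =
      (-1) ^ n * ∏ i ∈ Finset.Icc 1 n,
        (((poch (5 / 3) i * poch (1 / 6) i * poch (4 / 3) i * poch (-1 / 6) i) /
          (poch (3 / 2) (2 * i) * poch (1 / 2) (2 * i))) * (27 / 4) ^ (2 * i))) ∧
    (∀ n : ℕ, hankelDet 0 serE n =
      ∏ i ∈ Finset.range n,
        (5 * ((poch (2 / 3) i * poch (7 / 6) i * poch (4 / 3) i * poch (11 / 6) i) /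
          (poch (3 / 2) (2 * i) * poch (5 / 2) (2 * i))) * (27 / 4) ^ (2 * i))) ∧
    (∀ n : ℕ, hankelDet 1 serE n =
      ∏ i ∈ Finset.Icc 1 n,
        (2 * ((poch (2 / 3) i * poch (7 / 6) i * poch (1 / 3) i * poch (5 / 6) i) /
          (poch (3 / 2) (2 * i) * poch (1 / 2) (2 * i))) * (27 / 4) ^ (2 * i))) ∧
    -- the coincidences among them, in terms of Somos's determinants
    (∀ n : ℕ, somosU n = hankelDet 0 serA n) ∧
    (∀ n : ℕ, 1 ≤ n →
      somosU n = hankelDet 1 serB (n - 1) ∧ somosU n = hankelDet 0 serC (n - 1)) ∧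
    (∀ n : ℕ, somosV n = hankelDet 1 serA n ∧ somosV n = hankelDet 0 serB n) ∧
    (∀ n : ℕ, 1 ≤ n → somosV n = hankelDet 1 serC (n - 1)) ∧
    -- the product formulas for Somos's determinants
    (∀ n : ℕ, somosU n =
      ∏ i ∈ Finset.Ico 1 n,
        ((3 * (i : ℚ) + 1) * ((6 * i)! : ℚ) * ((2 * i)! : ℚ)) /
          (((4 * i + 1)! : ℚ) * ((4 * i)! : ℚ))) ∧
    (∀ n : ℕ, somosV n =
      ∏ i ∈ Finset.Icc 1 n,
        ((6 * i - 2).choose (2 * i) : ℚ) / (2 * ((4 * i - 1).choose (2 * i) : ℚ))) := by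
  
  have hA := hankelDet_zero_of_ratio (fun n => by positivity) serA_ratio
  have hB := hankelDet_zero_of_ratio (fun n => by positivity) serB_ratio
  have hV : ∀ n, somosV n = hankelDet 0 serB n := fun n => by
    rw [somosV_eq_hankelDet, hankelDet_one_step serA_step]
  have pos : ∀ (c : ℚ), 0 < c - 1 → ∀ n : ℕ, c - 1 + n ≠ 0 := fun c hc n => by positivity
  have hneg : ∀ n : ℕ, (1 / 2 - 1 + n : ℚ) ≠ 0 := fun n h => by
    have h1 : (2 * n : ℚ) = 1 := by linear_combination 2 * h
    have h2 : 2 * n = 1 := by exact_mod_cast h1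
    omega
  refine ⟨fun n => ⟨coeff_serA_factorial n, coeff_serA n⟩,
    fun n => ⟨coeff_serB_factorial n, coeff_serB n⟩,
    fun n => ⟨?_, ?_, coeff_serC n⟩, fun n => ⟨?_, coeff_serD n⟩, fun n => ⟨?_, coeff_serE n⟩,
    fun n => ?_, fun n => ?_, fun n => ?_, fun n => ?_, fun n => ?_, fun n => ?_, fun n => ?_,
    fun n => ?_, fun n => ?_, fun n => ?_, somosU_eq_hankelDet, fun n hn => ?_,
    fun n => ⟨somosV_eq_hankelDet n, hV n⟩, fun n hn => ?_, fun n => ?_, fun n => ?_⟩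
  · rw [coeff_serC, coeff_serB_eq_mul_serA, coeff_serA_factorial, Nat.factorial_succ (2 * n),
      Nat.factorial_succ n]
    push_cast
    field_simp
    ring
  · rw [coeff_serC, coeff_serB_eq_mul_serA, coeff_serA, ternaryNumber]
    field_simp
    ring
  · rw [coeff_serD, coeff_serB_eq_mul_serA, coeff_serA_factorial, Nat.factorial_succ n]
    push_cast
    field_simp
    ring
  · rw [coeff_serE, coeff_serB_eq_mul_serA, coeff_serA_factorial, Nat.factorial_succ n]
    push_cast
    field_simp
    ring
  · rw [hA]
    refine Finset.prod_congr rfl fun i _ => ?_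
    norm_num [gaussFactor]
  · rw [hankelDet_one_of_ratio hneg (by norm_num) (by norm_num) (by norm_num) serA_ratio]
    refine Finset.prod_congr rfl fun i _ => ?_
    norm_num [gaussFactorOne, mul_assoc]
  · rw [hB]
    refine Finset.prod_congr rfl fun i _ => ?_
    norm_num [gaussFactor]
  · rw [hankelDet_one_of_ratio (pos _ (by norm_num)) (by norm_num) (by norm_num) (by norm_num)
      serB_ratio]
    refine Finset.prod_congr rfl fun i _ => ?_
    norm_num [gaussFactorOne, mul_assoc]
  · rw [hankelDet_zero_of_ratio (fun n => by positivity) serC_ratio]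
    refine Finset.prod_congr rfl fun i _ => ?_
    norm_num [gaussFactor, mul_assoc]
  · rw [hankelDet_one_of_ratio (pos _ (by norm_num)) (by norm_num) (by norm_num) (by norm_num)
      serC_ratio]
    refine Finset.prod_congr rfl fun i _ => ?_
    norm_num [gaussFactorOne, mul_assoc]
  · rw [hankelDet_zero_of_ratio (fun n => by positivity) serD_ratio]
    refine Finset.prod_congr rfl fun i _ => ?_
    norm_num [gaussFactor, mul_assoc]
    rw [mul_comm (poch (3 / 2) _)]
  · rw [hankelDet_one_of_ratio (pos _ (by norm_num)) (by norm_num) (by norm_num) (by norm_num)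
      serD_ratio]
    -- the constant of `hankelDet_one_of_ratio` is `-1` here, which gives the sign
    have h : (-1 : ℚ) ^ n = ∏ _i ∈ Finset.Icc 1 n, (-1 : ℚ) := by simp
    rw [h, ← Finset.prod_mul_distrib]
    refine Finset.prod_congr rfl fun i _ => ?_
    norm_num [gaussFactorOne, mul_assoc]
  · rw [hankelDet_zero_of_ratio (fun n => by positivity) serE_ratio]
    refine Finset.prod_congr rfl fun i _ => ?_
    norm_num [gaussFactor, mul_assoc]
  · rw [hankelDet_one_of_ratio (pos _ (by norm_num)) (by norm_num) (by norm_num) (by norm_num)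
      serE_ratio]
    refine Finset.prod_congr rfl fun i _ => ?_
    norm_num [gaussFactorOne, mul_assoc]
  -- the coincidences: `b` and `c` are the first two tails of the continued fraction of `a`
  · obtain ⟨m, rfl⟩ := Nat.exists_eq_add_of_le' hn
    rw [Nat.add_sub_cancel, somosU_eq_hankelDet, hankelDet_zero_step serA_step]
    exact ⟨rfl, hankelDet_one_step serB_step m⟩
  · obtain ⟨m, rfl⟩ := Nat.exists_eq_add_of_le' hn
    rw [Nat.add_sub_cancel, hV, hankelDet_zero_step serB_step]
  · rw [somosU_eq_hankelDet, hA]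
    simp only [one_mul, gaussFactor_eq_somosU_factor]
    cases n with
    | zero => simp
    | succ n =>
      rw [Finset.range_eq_Ico, Finset.prod_eq_prod_Ico_succ_bot n.succ_pos]
      simp
  · rw [hV, hB, ← Finset.Ico_add_one_right_eq_Icc, Finset.prod_Ico_eq_prod_range,
      Nat.add_sub_cancel]
    refine Finset.prod_congr rfl fun i _ => ?_
    rw [add_comm 1 i, choose_quotient_eq_factorial, gaussFactor_eq_somosV_factor, one_mul]
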